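/- Let $G$ be a finite simple directed graph on a (totally ordered) vertex set $V$ that is strongly connected, and let $R$ be a commutative unital ring. A cut-vertex is a vertex whose removal disconnects the underlying undirected graph; the strong blocks $G_e$ ($e\in E$) of $G$ are its maximal connected subgraphs without cut-vertices. For each $e\in E$ let $a_e\in R$, and let $D^*_{G_e}$ be a square matrix over $R$, indexed by $V(G_e)$, with diagonal entries $1$. The matrices $D^*_G=(m_{ij})_{i,j\in V}$ and $D_{\mathcal G}=(d_{ij})_{i,j\in V}$ have principal submatrices $D^*_{G_e}$ and $D_{\mathcal G_e}:=a_e(D^*_{G_e}-J)$ on each $V(G_e)$, where $J$ is the all-ones matrix; if $i,j$ lie in no common strong block then, inductively, $m_{ij}=m_{iv}m_{vj}$ and $d_{ij}=d_{iv}+m_{iv}d_{vj}$ for any cut-vertex $v\ne i,j$ lying on every undirected path from $i$ to $j$. For $I,J'\subset V$ with $|I|=|J'|$ and $v_0\in V\setminus(I\cup J')$ let $$\kappa((D_{\mathcal G})_{I|J'},v_0):=\det\bigl(d_{ij}-d_{iv_0}-m_{iv_0}d_{v_0j}\bigr)_{i\in V\setminus(I\cup\{v_0\}),\ j\in V\setminus(J'\cup\{v_0\})},$$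 with rows and columns listed in increasing order. For $B\subset V$ and $v\in B$ let $\kappa(D_{\mathcal G}|_B,v):=\det(d_{ij}-d_{iv}-m_{iv}d_{vj})_{i,j\in B\setminus\{v\}}$. Let $I,J'\subset V$ satisfy: (a) $|I|=|J'|\le|V|-3$; (b) for each $i\in I\setminus J'$ there is a unique cut-vertex $c$ of $G$ in $V\setminus(I\cup J')$ such that every undirected path in $G$ from $i$ to a vertex of $V\setminus I$ contains $c$; and similarly with $I$ and $J'$ exchanged; (c) the induced subgraphs on $V\setminus I$, $V\setminus J'$ and $W:=V\setminus(I\cap J')$ are strongly connected. Let $E_\circ$ be the set of those $e\in E$ for which $B_e:=V(G_e)\cap W$ has at least two elements. Then: 1. If $I=J'$, then for every $v_0\in V\setminus(I\cup J')$ and every choice of nodes $v_e\in B_e$ ($e\in E_\circ$), $$\kappa((D_{\mathcal G})_{I|J'},v_0)=\prod_{e\in E_\circ}\kappa(D_{\mathcal G}|_{B_e},v_e).$$ 2. If $I=J'$ and the vertex set of every strong block of the induced subgraph on $W$ is one of the sets $B_e$, $e\in E_\circ$, then also, for every $v_0\in V\setminus(I\cup J')$ and every choice of nodes $v_B\in B$,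 $$\kappa((D_{\mathcal G})_{I|J'},v_0)=\prod_B\kappa(D_{\mathcal G}|_B,v_B),$$ where $B$ runs over the vertex sets of the strong blocks of the induced subgraph on $W$. 3. If $I\ne J'$, then $\kappa((D_{\mathcal G})_{I|J'},v_0)=0$ for every $v_0\in V\setminus(I\cup J')$. In particular, $\kappa((D_{\mathcal G})_{I|J'},v_0)$ does not depend on $v_0\in V\setminus(I\cup J')$. -/

import Mathlib

/-- `G` induces a strongly connected directed graph on `W`: any two vertices of `W` are joined by a
directed path all of whose vertices lie in `W`. -/
def Digraph.StronglyConnectedOn {V : Type*} (G : Digraph V) (W : Finset V) : Prop :=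
  ∀ u ∈ W, ∀ v ∈ W, Relation.ReflTransGen (fun x y => G.Adj x y ∧ x ∈ W ∧ y ∈ W) u v

/-- `v` is a cut-vertex of the subgraph of `G` induced on `B`: it belongs to `B`, and its removal
disconnects the underlying undirected graph of that subgraph. -/
def Digraph.IsCutVertexOn {V : Type*} (G : Digraph V) (B : Finset V) (v : V) : Prop :=
  v ∈ B ∧ ¬ (G.toSimpleGraphInclusive.induce ((B : Set V) \ {v})).Preconnected

/-- The subgraph of `G` induced on `B` is (nonempty and) connected and has no cut-vertex. -/
def Digraph.IsNonseparableOn {V : Type*} (G : Digraph V) (B : Finset V) : Prop :=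
  (G.toSimpleGraphInclusive.induce (B : Set V)).Connected ∧ ∀ v ∈ B, ¬ G.IsCutVertexOn B v

/-- `B` is the vertex set of a strong block of the subgraph of `G` induced on `W`, i.e. of a
maximal connected subgraph without cut-vertices. -/
def Digraph.IsStrongBlockOn {V : Type*} (G : Digraph V) (W B : Finset V) : Prop :=
  Maximal (fun C : Finset V => C ⊆ W ∧ G.IsNonseparableOn C) B

open scoped Classical in
/-- The (vertex sets of the) strong blocks of the subgraph of `G` induced on `W`. -/
noncomputable def Digraph.strongBlocksOn {V : Type*} [Fintype V] (G : Digraph V) (W : Finset V) :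
    Finset (Finset V) :=
  Finset.univ.filter fun B => G.IsStrongBlockOn W B

/-- The strong blocks of `G`, given by their vertex sets. -/
abbrev Digraph.StrongBlock {V : Type*} [Fintype V] (G : Digraph V) : Type _ :=
  {B : Finset V // G.IsStrongBlockOn Finset.univ B}

open scoped Classical in
/-- The parts `V(G_e) ∩ W` of the strong blocks `G_e` of `G` that survive in `W`, when they have at
least two vertices. -/
noncomputable def Digraph.survivingBlocks {V : Type*} [Fintype V] (G : Digraph V) (W : Finset V) :
    Finset (Finset V) :=
  ((G.strongBlocksOn Finset.univ).image fun B => B ∩ W).filter fun C => 2 ≤ C.card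

/-- `v` is a vertex other than `i` and `j` which lies on every path from `i` to `j` in the
underlying undirected graph (and there is such a path). Thus `v` is a cut-vertex of `G` located
between `i` and `j`. -/
def Digraph.Separates {V : Type*} (G : Digraph V) (v i j : V) : Prop :=
  v ≠ i ∧ v ≠ j ∧ G.toSimpleGraphInclusive.Reachable i j ∧
    ∀ p : G.toSimpleGraphInclusive.Walk i j, v ∈ p.support

theorem Digraph.Separates.dist_left_lt {V : Type*} {G : Digraph V} {v i j : V}
    (h : G.Separates v i j) :
    G.toSimpleGraphInclusive.dist i v < G.toSimpleGraphInclusive.dist i j := by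
  classical
  obtain ⟨-, hj, hr, hp⟩ := h
  obtain ⟨p, hlen⟩ := hr.exists_walk_length_eq_dist
  have hv := hp p
  rw [← hlen]
  exact lt_of_le_of_lt (SimpleGraph.dist_le (p.takeUntil v hv))
    (SimpleGraph.Walk.length_takeUntil_lt_length hv hj)

theorem Digraph.Separates.dist_right_lt {V : Type*} {G : Digraph V} {v i j : V}
    (h : G.Separates v i j) :
    G.toSimpleGraphInclusive.dist v j < G.toSimpleGraphInclusive.dist i j := by
  classical
  obtain ⟨hi, -, hr, hp⟩ := h
  obtain ⟨p, hlen⟩ := hr.exists_walk_length_eq_dist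
  have hv := hp p
  rw [← hlen]
  refine lt_of_le_of_lt (SimpleGraph.dist_le (p.dropUntil v hv)) ?_
  have hsum := congrArg SimpleGraph.Walk.length (p.take_spec hv)
  rw [SimpleGraph.Walk.length_append] at hsum
  have hpos : 0 < (p.takeUntil v hv).length := by
    rw [Nat.pos_iff_ne_zero]
    intro h0
    exact hi (SimpleGraph.Walk.eq_of_length_eq_zero h0).symm
  omega

/-- An additive-multiplicative block-datum on `G` over `R`: for each strong block `G_e`, a scalar
`a_e` and a square matrix `D*_{G_e}` indexed by the nodes of `G_e`, with diagonal entries `1`. -/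
structure BlockDatum {V : Type*} [Fintype V] (G : Digraph V) (R : Type*) [CommRing R] where
  /-- the additive data `a_e` -/
  a : G.StrongBlock → R
  /-- the multiplicative data `D*_{G_e}` -/
  mult : (e : G.StrongBlock) → Matrix e.1 e.1 R
  mult_diag : ∀ (e : G.StrongBlock) (i : e.1), mult e i i = 1

open scoped Classical in
/-- The entries `m_{ij}` of the multiplicative distance matrix `D*_G`: they are given by the datum
if `i, j` lie in a common strong block, and otherwise `m_{ij} = m_{iv} m_{vj}` for a cut-vertex `v`
between `i` and `j`. -/
noncomputable def BlockDatum.multDist {V : Type*} [Fintype V] {G : Digraph V} {R : Type*}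
    [CommRing R] (𝒢 : BlockDatum G R) (i j : V) : R :=
  if h : ∃ e : G.StrongBlock, i ∈ e.1 ∧ j ∈ e.1 then
    𝒢.mult h.choose ⟨i, h.choose_spec.1⟩ ⟨j, h.choose_spec.2⟩
  else if h' : ∃ v, G.Separates v i j then
    𝒢.multDist i h'.choose * 𝒢.multDist h'.choose j
  else 0
termination_by G.toSimpleGraphInclusive.dist i j
decreasing_by
  · exact h'.choose_spec.dist_left_lt
  · exact h'.choose_spec.dist_right_lt

open scoped Classical in
/-- The entries `d_{ij}` of the additive-multiplicative distance matrix: they are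
`a_e (m_{ij} - 1)` if `i, j` lie in a common strong block `G_e`, and otherwise
`d_{ij} = d_{iv} + m_{iv} d_{vj}` for a cut-vertex `v` between `i` and `j`. -/
noncomputable def BlockDatum.dist {V : Type*} [Fintype V] {G : Digraph V} {R : Type*}
    [CommRing R] (𝒢 : BlockDatum G R) (i j : V) : R :=
  if h : ∃ e : G.StrongBlock, i ∈ e.1 ∧ j ∈ e.1 then
    𝒢.a h.choose * (𝒢.mult h.choose ⟨i, h.choose_spec.1⟩ ⟨j, h.choose_spec.2⟩ - 1)
  else if h' : ∃ v, G.Separates v i j then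
    𝒢.dist i h'.choose + 𝒢.multDist i h'.choose * 𝒢.dist h'.choose j
  else 0
termination_by G.toSimpleGraphInclusive.dist i j
decreasing_by
  · exact h'.choose_spec.dist_left_lt
  · exact h'.choose_spec.dist_right_lt

theorem card_compl_insert_eq {V : Type*} [Fintype V] [DecidableEq V] {I J : Finset V} {v : V}
    (hcard : I.card = J.card) (hI : v ∉ I) (hJ : v ∉ J) :
    (insert v I)ᶜ.card = (insert v J)ᶜ.card := by
  rw [Finset.card_compl, Finset.card_compl, Finset.card_insert_of_notMem hI,
    Finset.card_insert_of_notMem hJ, hcard]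

/-- The invariant `κ((D_𝒢)_{I|J}, v₀)`. Removing from `D_𝒢` the rows in `I` and the columns in `J`
and writing what is left as a block matrix with blocks `D₁, u₁, w₁ᵀ, 0`, where the last row and the
last column belong to `v₀`, it is
`det (D₁ - u₁ eᵀ - m((I ∪ {v₀})ᶜ, v₀) w₁ᵀ)`.
The rows `(I ∪ {v₀})ᶜ` and the columns `(J ∪ {v₀})ᶜ` are each listed in increasing order. -/
noncomputable def BlockDatum.kappa {V : Type*} [Fintype V] [LinearOrder V] {G : Digraph V}
    {R : Type*} [CommRing R] (𝒢 : BlockDatum G R) (I J : Finset V) (v₀ : V)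
    (hcard : I.card = J.card) (hI : v₀ ∉ I) (hJ : v₀ ∉ J) : R :=
  let row : Fin (insert v₀ I)ᶜ.card → V := (insert v₀ I)ᶜ.orderEmbOfFin rfl
  let col : Fin (insert v₀ I)ᶜ.card → V :=
    (insert v₀ J)ᶜ.orderEmbOfFin (card_compl_insert_eq hcard hI hJ).symm
  Matrix.det (Matrix.of fun s t =>
    𝒢.dist (row s) (col t) - 𝒢.dist (row s) v₀ * 1 - 𝒢.multDist (row s) v₀ * 𝒢.dist v₀ (col t))

/-- The invariant `κ(D, v)` of the principal submatrix `D = (d(x, y))_{x, y ∈ B}` of `D_𝒢`, for a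
node `v ∈ B`: the same expression for one set of nodes, on which the listing is immaterial. -/
noncomputable def BlockDatum.kappaOn {V : Type*} [Fintype V] [DecidableEq V] {G : Digraph V}
    {R : Type*} [CommRing R] (𝒢 : BlockDatum G R) (B : Finset V) (v : V) : R :=
  Matrix.det (Matrix.of fun x y : B.erase v =>
    𝒢.dist x y - 𝒢.dist x v * 1 - 𝒢.multDist x v * 𝒢.dist v y)

/-- Every vertex of `I \ J` is connected to `V \ I` through a unique cut-vertex of `G` in
`V \ (I ∪ J)`. -/
def Digraph.ConnectedThroughCutVertex {V : Type*} [Fintype V] [DecidableEq V] (G : Digraph V)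
    (I J : Finset V) : Prop :=
  ∀ i ∈ I \ J, ∃! c, c ∉ I ∪ J ∧ G.IsCutVertexOn Finset.univ c ∧
    ∀ t ∉ I, ∀ p : G.toSimpleGraphInclusive.Walk i t, c ∈ p.support

/-! Write `b_v(x, y) = d(x, y) - d(x, v) - m(x, v) d(v, y)`; every `κ` is a determinant of such
entries. Suppose `I = J` and `W = Iᶜ`. If `v` separates two vertices of `W`, split `W` at `v` into
two sides sharing only `v`, with `v₀` on the side `U`. Subtracting `m(x, v)` times row `v` from each
row `x ≠ v` of the other side `T` kills the entries of these rows in the columns of `U`. The result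
is block triangular with diagonal determinants `κ(U, v₀)` and `κ(T, v)` (`kappaOn_union`). Cutting
continues until no separator is left (`kappaOn_eq_prod_kappaPart`); each remaining piece `C` then
lies in one strong block, where `κ = a_e ^ (|C| - 1) * det(m)` whatever the base vertex
(`kappaOn_eq_of_subset`). Suppose `I ≠ J`. A row `j ∈ J \ I` sees all columns through a vertex `c ∉
I ∪ J`, so it is `m(j, c)` times row `c`, or zero when `c = v₀`. Hence the determinant vanishes
(`kappa_eq_zero`). -/

/-! ### Walks avoiding a vertex, and inseparable sets. -/

namespace SimpleGraph

variable {V : Type*} {H : SimpleGraph V}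

/-- There is a walk from `x` to `y` which avoids `v`. -/
def ReachableAvoiding (H : SimpleGraph V) (v x y : V) : Prop :=
  ∃ p : H.Walk x y, v ∉ p.support

namespace ReachableAvoiding

theorem refl {v x : V} (h : v ≠ x) : H.ReachableAvoiding v x x :=
  ⟨Walk.nil, by simpa using h⟩

theorem symm {v x y : V} (h : H.ReachableAvoiding v x y) : H.ReachableAvoiding v y x := by
  obtain ⟨p, hp⟩ := h
  exact ⟨p.reverse, by simpa using hp⟩

theorem trans {v x y z : V} (h : H.ReachableAvoiding v x y) (h' : H.ReachableAvoiding v y z) :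
    H.ReachableAvoiding v x z := by
  obtain ⟨p, hp⟩ := h
  obtain ⟨q, hq⟩ := h'
  exact ⟨p.append q, by simp [Walk.mem_support_append_iff, hp, hq]⟩

theorem ne_left {v x y : V} (h : H.ReachableAvoiding v x y) : v ≠ x := by
  obtain ⟨p, hp⟩ := h
  rintro rfl
  exact hp p.start_mem_support

theorem ne_right {v x y : V} (h : H.ReachableAvoiding v x y) : v ≠ y :=
  h.symm.ne_left

end ReachableAvoiding

/-- An induced subgraph is preconnected iff its vertices are joined by walks inside it. -/
theorem induce_preconnected_iff {s : Set V} :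
    (H.induce s).Preconnected ↔
      ∀ x ∈ s, ∀ y ∈ s, ∃ p : H.Walk x y, ∀ z ∈ p.support, z ∈ s := by
  constructor
  · intro h x hx y hy
    obtain ⟨p⟩ := h ⟨x, hx⟩ ⟨y, hy⟩
    have hp : ∀ z ∈ (p.map (Embedding.induce s).toHom).support, z ∈ s := by
      intro z hz
      rw [Walk.support_map, List.mem_map] at hz
      obtain ⟨w, -, rfl⟩ := hz
      exact w.2
    exact ⟨_, hp⟩
  · rintro h ⟨x, hx⟩ ⟨y, hy⟩
    obtain ⟨p, hp⟩ := h x hx y hy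
    exact ⟨p.induce s hp⟩

/-- No vertex separates two vertices of `S`. -/
def Inseparable (H : SimpleGraph V) (S : Finset V) : Prop :=
  ∀ x ∈ S, ∀ y ∈ S, ∀ v, v ≠ x → v ≠ y → H.ReachableAvoiding v x y

/-- A path visits `v` at most once, so cutting it at `z` leaves a piece that misses `v`. -/
theorem Walk.IsPath.reachableAvoiding {x y z v : V} {p : H.Walk x y} (hp : p.IsPath)
    (hz : z ∈ p.support) (hv : v ≠ z) :
    H.ReachableAvoiding v z x ∨ H.ReachableAvoiding v z y := by
  classical
  by_cases h1 : v ∈ (p.takeUntil z hz).support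
  · right
    refine ⟨p.dropUntil z hz, fun h2 => ?_⟩
    have hnd := hp.support_nodup
    rw [← p.take_spec hz, Walk.support_append, List.nodup_append] at hnd
    rw [← Walk.cons_tail_support, List.mem_cons] at h2
    exact hnd.2.2 v h1 v (h2.resolve_left hv) rfl
  · left
    exact ⟨(p.takeUntil z hz).reverse, by simpa using h1⟩

/-- A path between two vertices of an inseparable set can be added to it. -/
theorem Inseparable.union_support [DecidableEq V] {S : Finset V} (hS : H.Inseparable S) {x y : V}
    (hx : x ∈ S) (hy : y ∈ S) {p : H.Walk x y} (hp : p.IsPath) :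
    H.Inseparable (S ∪ p.support.toFinset) := by
  have key : ∀ z ∈ S ∪ p.support.toFinset, ∀ v, v ≠ z → ∃ w ∈ S, H.ReachableAvoiding v z w := by
    intro z hz v hv
    rw [Finset.mem_union, List.mem_toFinset] at hz
    rcases hz with hz | hz
    · exact ⟨z, hz, .refl hv⟩
    · rcases hp.reachableAvoiding hz hv with h | h
      · exact ⟨x, hx, h⟩
      · exact ⟨y, hy, h⟩
  intro z hz z' hz' v hv hv'
  obtain ⟨w, hw, h⟩ := key z hz v hv
  obtain ⟨w', hw', h'⟩ := key z' hz' v hv'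
  exact (h.trans (hS w hw w' hw' v h.ne_right h'.ne_right)).trans h'.symm

theorem Inseparable.support_subset {S : Finset V} (hS : Maximal H.Inseparable S) {x y : V}
    (hx : x ∈ S) (hy : y ∈ S) {p : H.Walk x y} (hp : p.IsPath) : ∀ z ∈ p.support, z ∈ S := by
  classical
  intro z hz
  exact hS.le_of_ge (hS.prop.union_support hx hy hp) Finset.subset_union_left
    (Finset.mem_union_right _ (List.mem_toFinset.2 hz))

end SimpleGraph

/-! ### Separating vertices and strong blocks. -/

namespace Digraph

open SimpleGraph

variable {V : Type*} {G : Digraph V}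

theorem separates_iff (hG : G.toSimpleGraphInclusive.Preconnected) {v i j : V} :
    G.Separates v i j ↔
      v ≠ i ∧ v ≠ j ∧ ¬ G.toSimpleGraphInclusive.ReachableAvoiding v i j := by
  simp only [Separates, ReachableAvoiding, not_exists, not_not]
  exact ⟨fun h => ⟨h.1, h.2.1, h.2.2.2⟩, fun h => ⟨h.1, h.2.1, hG i j, h.2.2⟩⟩

theorem Separates.symm {v i j : V} (h : G.Separates v i j) : G.Separates v j i := by
  refine ⟨h.2.1, h.1, h.2.2.1.symm, fun p => ?_⟩
  simpa using h.2.2.2 p.reverse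

/-- Each of `u`, `v` would be strictly closer to `i` than the other. -/
theorem Separates.not_swap {u v i : V} (h : G.Separates v i u) : ¬ G.Separates u i v :=
  fun h' => lt_asymm h.dist_left_lt h'.dist_left_lt

/-- Two vertices between `i` and `j` come in a definite order. -/
theorem Separates.order (hG : G.toSimpleGraphInclusive.Preconnected) {u v i j : V}
    (hu : G.Separates u i j) (hv : G.Separates v i j) (huv : u ≠ v) :
    (G.Separates v i u ∧ G.Separates u v j) ∨ (G.Separates u i v ∧ G.Separates v u j) := by
  rw [separates_iff hG] at hu hv
  -- Otherwise walks `i → u → j` avoiding `v` could be joined; symmetrically for `h2`.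
  have h1 : G.Separates v i u ∨ G.Separates v u j := by
    by_contra! h
    simp only [separates_iff hG, not_and, not_not] at h
    exact hv.2.2 ((h.1 hv.1 huv.symm).trans (h.2 huv.symm hv.2.1))
  have h2 : G.Separates u i v ∨ G.Separates u v j := by
    by_contra! h
    simp only [separates_iff hG, not_and, not_not] at h
    exact hu.2.2 ((h.1 hu.1 huv).trans (h.2 huv hu.2.1))
  rcases h1 with h1 | h1 <;> rcases h2 with h2 | h2
  · exact absurd h2 h1.not_swap
  · exact .inl ⟨h1, h2⟩
  · exact .inr ⟨h2, h1⟩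
  · exact absurd h2.symm h1.symm.not_swap

theorem StronglyConnectedOn.exists_walk {W : Finset V} (hW : G.StronglyConnectedOn W) {x y : V}
    (hx : x ∈ W) (hy : y ∈ W) :
    ∃ p : G.toSimpleGraphInclusive.Walk x y, ∀ z ∈ p.support, z ∈ W := by
  have h := hW x hx y hy
  induction h with
  | refl => exact ⟨Walk.nil, by simpa using hx⟩
  | @tail b c _ hbc ih =>
    obtain ⟨p, hp⟩ := ih hbc.2.1
    by_cases hne : b = c
    · subst hne
      exact ⟨p, hp⟩
    · have hadj : G.toSimpleGraphInclusive.Adj b c :=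
        (SimpleGraph.fromRel_adj ..).2 ⟨hne, .inl hbc.1⟩
      refine ⟨p.concat hadj, fun z hz => ?_⟩
      rw [Walk.support_concat, List.mem_append, List.mem_singleton] at hz
      rcases hz with hz | rfl
      · exact hp z hz
      · exact hbc.2.2

theorem StronglyConnectedOn.preconnected [Fintype V] (hG : G.StronglyConnectedOn Finset.univ) :
    G.toSimpleGraphInclusive.Preconnected := fun x y =>
  let ⟨p, _⟩ := hG.exists_walk (Finset.mem_univ x) (Finset.mem_univ y)
  ⟨p⟩

theorem IsNonseparableOn.inseparable {B : Finset V} (hB : G.IsNonseparableOn B) :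
    G.toSimpleGraphInclusive.Inseparable B := by
  intro x hx y hy v hvx hvy
  by_cases hv : v ∈ B
  · have h : (G.toSimpleGraphInclusive.induce ((B : Set V) \ {v})).Preconnected := by
      by_contra h
      exact hB.2 v hv ⟨hv, h⟩
    obtain ⟨p, hp⟩ := induce_preconnected_iff.1 h x ⟨hx, hvx.symm⟩ y ⟨hy, hvy.symm⟩
    exact ⟨p, fun h' => (hp v h').2 rfl⟩
  · obtain ⟨p, hp⟩ := induce_preconnected_iff.1 hB.1.preconnected x hx y hy
    exact ⟨p, fun h' => hv (hp v h')⟩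

/-- Inseparability allows walks through the whole graph. Maximality forces paths between vertices of
`S` to stay in `S`, so these walks yield connections in the induced subgraph. -/
theorem isNonseparableOn_of_maximal (hG : G.toSimpleGraphInclusive.Preconnected) {S : Finset V}
    (hS : Maximal G.toSimpleGraphInclusive.Inseparable S) (hne : S.Nonempty) :
    G.IsNonseparableOn S := by
  classical
  constructor
  · have : Nonempty (S : Set V) := hne.to_subtype
    refine ⟨induce_preconnected_iff.2 fun x hx y hy => ?_⟩
    obtain ⟨p⟩ := hG x y
    exact ⟨p.toPath, Inseparable.support_subset hS hx hy p.toPath.2⟩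
  · rintro v - ⟨hv, h⟩
    refine h (induce_preconnected_iff.2 fun x hx y hy => ?_)
    obtain ⟨p, hp⟩ := hS.prop x hx.1 y hy.1 v (Ne.symm hx.2) (Ne.symm hy.2)
    refine ⟨p.toPath, fun z hz =>
      ⟨Inseparable.support_subset hS hx.1 hy.1 p.toPath.2 z hz, ?_⟩⟩
    rintro rfl
    exact hp (p.support_toPath_subset_support hz)

theorem IsStrongBlockOn.inseparable {W B : Finset V} (hB : G.IsStrongBlockOn W B) :
    G.toSimpleGraphInclusive.Inseparable B :=
  hB.prop.2.inseparable

theorem IsStrongBlockOn.nonempty {W B : Finset V} (hB : G.IsStrongBlockOn W B) :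
    B.Nonempty := by
  obtain ⟨x, hx⟩ := hB.prop.2.1.nonempty
  exact ⟨x, hx⟩

section Blocks

variable [Fintype V]

/-- An inseparable set of vertices is contained in a strong block. -/
theorem exists_strongBlock_of_inseparable (hG : G.toSimpleGraphInclusive.Preconnected)
    {S : Finset V} (hS : G.toSimpleGraphInclusive.Inseparable S) (hne : S.Nonempty) :
    ∃ B, G.IsStrongBlockOn Finset.univ B ∧ S ⊆ B := by
  obtain ⟨T, hST, hT⟩ := Finite.exists_le_maximal hS
  obtain ⟨B, hTB, hB⟩ := Finite.exists_le_maximal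
    (p := fun C : Finset V => C ⊆ Finset.univ ∧ G.IsNonseparableOn C)
    ⟨Finset.subset_univ T, isNonseparableOn_of_maximal hG hT (hne.mono hST)⟩
  exact ⟨B, hB, hST.trans hTB⟩

/-- This replaces blocks, defined through induced subgraphs, by a condition on walks of the whole
graph: a larger inseparable set would lie in a strong block containing `B`, hence in `B`. -/
theorem IsStrongBlockOn.maximal_inseparable (hG : G.toSimpleGraphInclusive.Preconnected)
    {B : Finset V} (hB : G.IsStrongBlockOn Finset.univ B) :
    Maximal G.toSimpleGraphInclusive.Inseparable B := by
  refine ⟨hB.inseparable, fun T hT hBT => ?_⟩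
  obtain ⟨B', hB', hTB'⟩ := exists_strongBlock_of_inseparable hG hT (hB.nonempty.mono hBT)
  exact hTB'.trans (hB.le_of_ge hB'.prop (hBT.trans hTB'))

/-- Two strong blocks with two vertices in common are equal. -/
theorem IsStrongBlockOn.eq_of_mem (hG : G.toSimpleGraphInclusive.Preconnected)
    {B B' : Finset V} (hB : G.IsStrongBlockOn Finset.univ B)
    (hB' : G.IsStrongBlockOn Finset.univ B') {x y : V} (hxy : x ≠ y) (hx : x ∈ B) (hy : y ∈ B)
    (hx' : x ∈ B') (hy' : y ∈ B') : B = B' := by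
  classical
  -- At least one of the common vertices `x`, `y` differs from `v`; the walk goes through it.
  have key : ∀ z ∈ B, ∀ z' ∈ B', ∀ v, v ≠ z → v ≠ z' →
      G.toSimpleGraphInclusive.ReachableAvoiding v z z' := by
    intro z hz z' hz' v hv hv'
    by_cases h : v = x
    · subst h
      exact (hB.inseparable z hz y hy v hv hxy).trans (hB'.inseparable y hy' z' hz' v hxy hv')
    · exact (hB.inseparable z hz x hx v hv h).trans (hB'.inseparable x hx' z' hz' v h hv')
  have hU : G.toSimpleGraphInclusive.Inseparable (B ∪ B') := by
    intro z hz z' hz' v hv hv'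
    rcases Finset.mem_union.1 hz with hz | hz <;> rcases Finset.mem_union.1 hz' with hz' | hz'
    · exact hB.inseparable z hz z' hz' v hv hv'
    · exact key z hz z' hz' v hv hv'
    · exact (key z' hz' z hz v hv' hv).symm
    · exact hB'.inseparable z hz z' hz' v hv hv'
  exact ((hB.maximal_inseparable hG).eq_of_le hU Finset.subset_union_left).trans
    ((hB'.maximal_inseparable hG).eq_of_le hU Finset.subset_union_right).symm

/-- The vertices of a pair belong to a common strong block unless they are separated. -/
theorem exists_strongBlock_iff (hG : G.toSimpleGraphInclusive.Preconnected) {i j : V} :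
    (∃ e : G.StrongBlock, i ∈ e.1 ∧ j ∈ e.1) ↔ ¬ ∃ v, G.Separates v i j := by
  classical
  simp only [separates_iff hG, not_exists, not_and, not_not]
  constructor
  · rintro ⟨e, hi, hj⟩ v hvi hvj
    exact e.2.inseparable i hi j hj v hvi hvj
  · intro h
    obtain ⟨B, hB, hS⟩ := exists_strongBlock_of_inseparable hG (S := {i, j}) (by
      intro x hx y hy v hvx hvy
      rw [Finset.mem_insert, Finset.mem_singleton] at hx hy
      rcases hx with rfl | rfl <;> rcases hy with rfl | rfl
      · exact .refl hvx
      · exact h v hvx hvy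
      · exact (h v hvy hvx).symm
      · exact .refl hvx) ⟨i, by simp⟩
    exact ⟨⟨B, hB⟩, hS (by simp), hS (by simp)⟩

end Blocks

/-- `W` contains every vertex which separates two of its elements. -/
def SeparatorClosed (G : Digraph V) (W : Finset V) : Prop :=
  ∀ x ∈ W, ∀ y ∈ W, ∀ v, G.Separates v x y → v ∈ W

theorem StronglyConnectedOn.separatorClosed {W : Finset V} (hW : G.StronglyConnectedOn W) :
    G.SeparatorClosed W := by
  intro x hx y hy v hv
  obtain ⟨p, hp⟩ := hW.exists_walk hx hy
  exact hp v (hv.2.2.2 p)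

/-- A part `U ∋ v` of a separator-closed set, cut off from the rest of it by `v`, is
separator-closed. -/
theorem SeparatorClosed.of_forall (hG : G.toSimpleGraphInclusive.Preconnected) {W U : Finset V}
    (hW : G.SeparatorClosed W) (hU : U ⊆ W) {v : V}
    (h : ∀ x ∈ U, ∀ u ∈ W, u ∉ U → x ≠ v →
      ¬ G.toSimpleGraphInclusive.ReachableAvoiding v x u) (hv : v ∈ U) :
    G.SeparatorClosed U := by
  intro x hx y hy u hu
  by_contra huU
  have huW := hW x (hU hx) y (hU hy) u hu
  -- Otherwise `u` separates `z` from `v` while `v` separates `z` from `u`, contradicting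
  -- `not_swap`.
  have key : ∀ z ∈ U, u ≠ z → G.toSimpleGraphInclusive.ReachableAvoiding u z v := by
    intro z hz huz
    have huv : u ≠ v := fun e => huU (e ▸ hv)
    by_cases hzv : z = v
    · subst hzv
      exact .refl huz
    · by_contra hn
      have h1 : G.Separates u z v := (separates_iff hG).2 ⟨huz, huv, hn⟩
      exact h1.not_swap ((separates_iff hG).2 ⟨Ne.symm hzv, huv.symm, h z hz u huW huU hzv⟩)
  exact ((separates_iff hG).1 hu).2.2 ((key x hx hu.1).trans (key y hy hu.2.1).symm)

end Digraph

/-! ### Determinants indexed by finite sets of nodes. -/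

namespace Matrix

variable {V R : Type*} [DecidableEq V] [CommRing R]

theorem det_of_finset_congr {s t : Finset V} (h : s = t) {F F' : V → V → R}
    (hF : ∀ x ∈ s, ∀ y ∈ s, F x y = F' x y) :
    det (of fun x y : s => F x y) = det (of fun x y : t => F' x y) := by
  subst h
  congr 1
  ext x y
  exact hF x x.2 y y.2

theorem det_toSquareBlockProp_of_finset {s t : Finset V} (p : s → Prop) [DecidablePred p]
    (F : V → V → R) (h : ∀ x, x ∈ t ↔ ∃ hx : x ∈ s, p ⟨x, hx⟩) :
    (toSquareBlockProp (of fun x y : s => F x y) p).det = det (of fun x y : t => F x y) := by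
  let e : {a : s // p a} ≃ t :=
    { toFun := fun a => ⟨a.1.1, (h _).2 ⟨a.1.2, a.2⟩⟩
      invFun := fun x => ⟨⟨x.1, ((h _).1 x.2).1⟩, ((h _).1 x.2).2⟩
      left_inv := fun _ => rfl
      right_inv := fun _ => rfl }
  rw [← det_submatrix_equiv_self e]
  rfl

/-- The determinant of a block triangular matrix indexed by a finite set of nodes. -/
theorem det_of_finset_triangular {s t u : Finset V} (F : V → V → R)
    (hs : ∀ x, x ∈ s ↔ x ∈ t ∨ x ∈ u) (hd : Disjoint t u) (h : ∀ x ∈ u, ∀ y ∈ t, F x y = 0) :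
    det (of fun x y : s => F x y) =
      det (of fun x y : t => F x y) * det (of fun x y : u => F x y) := by
  rw [twoBlockTriangular_det _ fun x : s => (x : V) ∈ t]
  · congr 1
    · exact det_toSquareBlockProp_of_finset _ F fun x =>
        ⟨fun hx => ⟨(hs x).2 (.inl hx), hx⟩, fun hx => hx.2⟩
    · exact det_toSquareBlockProp_of_finset _ F fun x =>
        ⟨fun hx => ⟨(hs x).2 (.inr hx), fun ht => Finset.disjoint_left.1 hd ht hx⟩,
          fun ⟨hx, ht⟩ => ((hs x).1 hx).resolve_left ht⟩
  · intro x hx y hy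
    exact h x (((hs x).1 x.2).resolve_left hx) y hy

theorem det_of_finset_rowOperation {s : Finset V} {F F' : V → V → R} {k : V} (hk : k ∈ s)
    (c : V → R) (hc : c k = 0) (h : ∀ x ∈ s, ∀ y ∈ s, F x y = F' x y + c x * F' k y) :
    det (of fun x y : s => F x y) = det (of fun x y : s => F' x y) :=
  det_eq_of_forall_row_eq_smul_add_const (fun x : s => c x) ⟨k, hk⟩ hc
    fun x y => h x x.2 y y.2

theorem det_eq_zero_of_row_eq_smul {n : Type*} [DecidableEq n] [Fintype n] {M : Matrix n n R}
    {i j : n} (hij : i ≠ j) (c : R) (h : ∀ k, M i k = c * M j k) : M.det = 0 := by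
  have h1 : M = M.updateRow i (c • M j) := by
    ext x y
    by_cases hx : x = i
    · subst hx
      simp [h]
    · rw [updateRow_ne hx]
  rw [h1, det_updateRow_smul, det_zero_of_row_eq hij, mul_zero]
  rw [updateRow_self, updateRow_ne hij.symm]

end Matrix

/-! ### Distance entries, and `κ` under cutting at a vertex. -/

namespace BlockDatum

open Digraph Matrix

variable {V : Type*} [Fintype V] {G : Digraph V} {R : Type*} [CommRing R] (𝒢 : BlockDatum G R)

theorem multDist_self (hG : G.toSimpleGraphInclusive.Preconnected) (i : V) :
    𝒢.multDist i i = 1 := by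
  have h : ∃ e : G.StrongBlock, i ∈ e.1 ∧ i ∈ e.1 :=
    (exists_strongBlock_iff hG).2 fun ⟨v, hv⟩ => by
      simpa [SimpleGraph.Walk.support_nil, hv.1] using hv.2.2.2 .nil
  rw [multDist, dif_pos h]
  exact 𝒢.mult_diag _ _

/-- On a strong block, `D_𝒢` is `a_e (D*_G - J)`. -/
theorem dist_eq_of_mem (hG : G.toSimpleGraphInclusive.Preconnected) (e : G.StrongBlock) {i j : V}
    (hi : i ∈ e.1) (hj : j ∈ e.1) : 𝒢.dist i j = 𝒢.a e * (𝒢.multDist i j - 1) := by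
  have h : ∃ e : G.StrongBlock, i ∈ e.1 ∧ j ∈ e.1 := ⟨e, hi, hj⟩
  rw [dist, dif_pos h]
  -- A single vertex may lie in several blocks, so the chosen one need not be `e`; but both sides
  -- are then `0`.
  by_cases hij : i = j
  · subst hij
    rw [𝒢.multDist_self hG, 𝒢.mult_diag]
    simp
  · have he : h.choose = e := Subtype.ext
      (h.choose.2.eq_of_mem hG e.2 hij h.choose_spec.1 h.choose_spec.2 hi hj)
    rw [multDist, dif_pos h]
    congr 2

theorem dist_self (hG : G.toSimpleGraphInclusive.Preconnected) (i : V) : 𝒢.dist i i = 0 := by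
  obtain ⟨e, he, -⟩ : ∃ e : G.StrongBlock, i ∈ e.1 ∧ i ∈ e.1 :=
    (exists_strongBlock_iff hG).2 fun ⟨v, hv⟩ => by
      simpa [SimpleGraph.Walk.support_nil, hv.1] using hv.2.2.2 .nil
  rw [𝒢.dist_eq_of_mem hG e he he, 𝒢.multDist_self hG, sub_self, mul_zero]

/-- The entries of the two distance matrices are determined by any separating vertex. -/
theorem multDist_dist_of_separates (hG : G.toSimpleGraphInclusive.Preconnected) :
    ∀ (n : ℕ) {v i j : V}, G.toSimpleGraphInclusive.dist i j = n → G.Separates v i j →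
      𝒢.multDist i j = 𝒢.multDist i v * 𝒢.multDist v j ∧
      𝒢.dist i j = 𝒢.dist i v + 𝒢.multDist i v * 𝒢.dist v j := by
  intro n
  induction n using Nat.strong_induction_on with
  | _ n ih =>
    intro v i j hn hv
    have hs : ∃ v, G.Separates v i j := ⟨v, hv⟩
    have hb : ¬ ∃ e : G.StrongBlock, i ∈ e.1 ∧ j ∈ e.1 := fun h =>
      (exists_strongBlock_iff hG).1 h hs
    rw [multDist, dif_neg hb, dif_pos hs, dist, dif_neg hb, dif_pos hs]
    -- `u` is the separator picked by both recursive definitions. If it differs from `v`, the two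
    -- are ordered along `i, j`, and expanding at both gives the same value by induction on the
    -- distance.
    have hu := hs.choose_spec
    set u := hs.choose
    by_cases huv : u = v
    · rw [huv]
      exact ⟨rfl, rfl⟩
    · rcases hu.order hG hv huv with ⟨h1, h2⟩ | ⟨h1, h2⟩
      · obtain ⟨m1, d1⟩ := ih _ (hn ▸ hu.dist_left_lt) rfl h1
        obtain ⟨m2, d2⟩ := ih _ (hn ▸ hv.dist_right_lt) rfl h2
        rw [m1, d1, m2, d2]
        constructor <;> ring
      · obtain ⟨m1, d1⟩ := ih _ (hn ▸ hv.dist_left_lt) rfl h1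
        obtain ⟨m2, d2⟩ := ih _ (hn ▸ hu.dist_right_lt) rfl h2
        rw [m1, d1, m2, d2]
        constructor <;> ring

theorem multDist_of_separates (hG : G.toSimpleGraphInclusive.Preconnected) {v i j : V}
    (h : G.Separates v i j) : 𝒢.multDist i j = 𝒢.multDist i v * 𝒢.multDist v j :=
  (𝒢.multDist_dist_of_separates hG _ rfl h).1

theorem dist_of_separates (hG : G.toSimpleGraphInclusive.Preconnected) {v i j : V}
    (h : G.Separates v i j) : 𝒢.dist i j = 𝒢.dist i v + 𝒢.multDist i v * 𝒢.dist v j :=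
  (𝒢.multDist_dist_of_separates hG _ rfl h).2

/-- The entries of the matrix whose determinant is `κ(D_𝒢, v)`. -/
noncomputable def basedDist (v x y : V) : R :=
  𝒢.dist x y - 𝒢.dist x v * 1 - 𝒢.multDist x v * 𝒢.dist v y

theorem basedDist_self (hG : G.toSimpleGraphInclusive.Preconnected) (v y : V) :
    𝒢.basedDist v v y = 0 := by
  rw [basedDist, 𝒢.dist_self hG, 𝒢.multDist_self hG]
  ring

section Kappa

variable [DecidableEq V]

theorem kappaOn_eq_det (B : Finset V) (v : V) :
    𝒢.kappaOn B v = det (of fun x y : B.erase v => 𝒢.basedDist v x y) := rfl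

theorem kappaOn_singleton (v : V) : 𝒢.kappaOn {v} v = 1 := by
  rw [kappaOn_eq_det]
  have : IsEmpty (({v} : Finset V).erase v : Finset V) := by
    rw [Finset.isEmpty_coe_sort, Finset.erase_singleton]
  exact det_isEmpty

/-- On a strong block, `κ` is given by the determinant of the multiplicative distance matrix. -/
theorem kappaOn_eq_of_subset (hG : G.toSimpleGraphInclusive.Preconnected) (e : G.StrongBlock)
    {C : Finset V} (hC : C ⊆ e.1) {v : V} (hv : v ∈ C) :
    𝒢.kappaOn C v =
      𝒢.a e ^ (C.card - 1) * det (of fun x y : C => 𝒢.multDist x y) := by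
  -- Elimination with pivot `m(v, v) = 1`: away from `v`, the entries `m(x, y) - m(x, v) m(v, y)`
  -- are `b_v(x, y)` up to the factor `a_e`.
  let F : V → V → R := fun x y =>
    𝒢.multDist x y - (if x = v then 0 else 𝒢.multDist x v) * 𝒢.multDist v y
  have h1 : det (of fun x y : C => 𝒢.multDist x y) = det (of fun x y : C => F x y) :=
    det_of_finset_rowOperation hv (fun x => if x = v then 0 else 𝒢.multDist x v) (by simp)
      fun x _ y _ => by simp [F]
  have h2 : det (of fun x y : C => F x y) =
      det (of fun x y : ({v} : Finset V) => F x y) * det (of fun x y : C.erase v => F x y) := by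
    refine det_of_finset_triangular F (fun x => ?_) (by simp) fun x hx y hy => ?_
    · by_cases hx : x = v
      · simp [hx, hv]
      · simp [hx]
    · rw [Finset.mem_singleton] at hy
      subst hy
      simp [F, Finset.ne_of_mem_erase hx, 𝒢.multDist_self hG]
  have h3 : det (of fun x y : ({v} : Finset V) => F x y) = 1 := by
    rw [det_unique]
    simp [F, 𝒢.multDist_self hG]
  have h4 : (of fun x y : C.erase v => 𝒢.basedDist v x y) =
      𝒢.a e • of fun x y : C.erase v => F x y := by
    ext ⟨x, hx⟩ ⟨y, hy⟩
    have hxe := hC (Finset.mem_of_mem_erase hx)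
    have hye := hC (Finset.mem_of_mem_erase hy)
    simp only [of_apply, Matrix.smul_apply, smul_eq_mul, F, if_neg (Finset.ne_of_mem_erase hx), basedDist,
      𝒢.dist_eq_of_mem hG e hxe hye, 𝒢.dist_eq_of_mem hG e hxe (hC hv),
      𝒢.dist_eq_of_mem hG e (hC hv) hye]
    ring
  rw [kappaOn_eq_det, h4, det_smul, h1, h2, h3, one_mul, Fintype.card_coe,
    Finset.card_erase_of_mem hv]

/-- Cutting at a vertex `v` which separates `T \ {v}` from `U`. -/
theorem kappaOn_union (hG : G.toSimpleGraphInclusive.Preconnected) {U T : Finset V} {v₀ v : V}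
    (hv₀ : v₀ ∈ U) (hvU : v ∈ U) (hd : Disjoint U (T.erase v))
    (hsep : ∀ x ∈ T.erase v, ∀ y ∈ U, y ≠ v → G.Separates v x y) :
    𝒢.kappaOn (U ∪ T) v₀ = 𝒢.kappaOn U v₀ * 𝒢.kappaOn T v := by
  have hm : ∀ x ∈ T.erase v, ∀ y ∈ U, 𝒢.multDist x y = 𝒢.multDist x v * 𝒢.multDist v y := by
    intro x hx y hy
    by_cases h : y = v
    · rw [h, 𝒢.multDist_self hG, mul_one]
    · exact 𝒢.multDist_of_separates hG (hsep x hx y hy h)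
  have hdist : ∀ x ∈ T.erase v, ∀ y ∈ U,
      𝒢.dist x y = 𝒢.dist x v + 𝒢.multDist x v * 𝒢.dist v y := by
    intro x hx y hy
    by_cases h : y = v
    · rw [h, 𝒢.dist_self hG, mul_zero, add_zero]
    · exact 𝒢.dist_of_separates hG (hsep x hx y hy h)
  let c : V → R := fun x => if x ∈ T.erase v then 𝒢.multDist x v else 0
  let F : V → V → R := fun x y => 𝒢.basedDist v₀ x y - c x * 𝒢.basedDist v₀ v y
  have hcv : c v = 0 := by simp [c]
  have hF : det (of fun x y : (U ∪ T).erase v₀ => 𝒢.basedDist v₀ x y) =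
      det (of fun x y : (U ∪ T).erase v₀ => F x y) := by
    -- When `v = v₀` there is no row `v` to subtract, but `b_v(v, y) = 0` makes the operation
    -- trivial.
    by_cases h : v = v₀
    · refine det_of_finset_congr rfl fun x _ y _ => ?_
      simp [F, h, 𝒢.basedDist_self hG]
    · refine det_of_finset_rowOperation
        (Finset.mem_erase.2 ⟨h, Finset.mem_union_left _ hvU⟩) c hcv fun x _ y _ => ?_
      simp [F, hcv]
  have hnot : ∀ x ∈ U, x ∉ T.erase v := fun _ hx => Finset.disjoint_left.1 hd hx
  rw [kappaOn_eq_det, kappaOn_eq_det, kappaOn_eq_det, hF, det_of_finset_triangular (t := U.erase v₀) (u := T.erase v) F]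
  · congr 1
    · refine det_of_finset_congr rfl fun x hx y _ => ?_
      simp only [F, c, if_neg (hnot x (Finset.mem_of_mem_erase hx)), zero_mul, sub_zero]
    · refine det_of_finset_congr rfl fun x hx y _ => ?_
      simp only [F, c, if_pos hx, basedDist, hm x hx v₀ hv₀, hdist x hx v₀ hv₀]
      ring
  · intro x
    have h1 := hnot v₀ hv₀
    have h2 : x = v → x ∈ U := fun h => h ▸ hvU
    have h3 : x = v₀ → x ∉ T.erase v := fun h => h ▸ h1
    simp only [Finset.mem_erase, Finset.mem_union, ne_eq] at h1 h3 ⊢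
    tauto
  · exact hd.mono_left (Finset.erase_subset _ _)
  · intro x hx y hy
    have hyU := Finset.mem_of_mem_erase hy
    simp only [F, c, if_pos hx, basedDist, hm x hx v₀ hv₀, hdist x hx v₀ hv₀, hdist x hx y hyU]
    ring

end Kappa

end BlockDatum

/-! ### Surviving parts of strong blocks. -/

namespace Digraph

open SimpleGraph

variable {V : Type*} {G : Digraph V}

theorem isNonseparableOn_pair [DecidableEq V] {x y : V} (h : G.toSimpleGraphInclusive.Adj x y) :
    G.IsNonseparableOn {x, y} := by
  constructor
  · have : Nonempty (({x, y} : Finset V) : Set V) := ⟨⟨x, by simp⟩⟩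
    refine ⟨induce_preconnected_iff.2 fun a ha b hb => ?_⟩
    simp only [Finset.coe_insert, Finset.coe_singleton, Set.mem_insert_iff,
      Set.mem_singleton_iff] at ha hb ⊢
    rcases ha with rfl | rfl <;> rcases hb with rfl | rfl
    · exact ⟨.nil, by simp⟩
    · exact ⟨h.toWalk, by simp⟩
    · exact ⟨h.symm.toWalk, by simp⟩
    · exact ⟨.nil, by simp⟩
  · rintro v hv ⟨-, hn⟩
    refine hn (induce_preconnected_iff.2 fun a ha b hb => ?_)
    have hab : a = b := by
      simp only [Finset.mem_insert, Finset.mem_singleton, Finset.coe_insert, Finset.coe_singleton,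
        Set.mem_sdiff, Set.mem_insert_iff, Set.mem_singleton_iff] at hv ha hb
      grind
    subst hab
    exact ⟨.nil, by simpa using ha⟩

variable [Fintype V]

theorem mem_strongBlocksOn {W B : Finset V} :
    B ∈ G.strongBlocksOn W ↔ G.IsStrongBlockOn W B := by
  simp [strongBlocksOn]

/-- A surviving part determines its strong block. -/
theorem IsStrongBlockOn.eq_of_two_le_card (hG : G.toSimpleGraphInclusive.Preconnected)
    {B B' C : Finset V} (hB : G.IsStrongBlockOn Finset.univ B)
    (hB' : G.IsStrongBlockOn Finset.univ B') (hC : 2 ≤ C.card) (h : C ⊆ B) (h' : C ⊆ B') :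
    B = B' := by
  obtain ⟨x, hx, y, hy, hxy⟩ := Finset.one_lt_card.1 hC
  exact hB.eq_of_mem hG hB' hxy (h hx) (h hy) (h' hx) (h' hy)

variable [DecidableEq V]

theorem mem_survivingBlocks {W C : Finset V} :
    C ∈ G.survivingBlocks W ↔
      ∃ B, G.IsStrongBlockOn Finset.univ B ∧ B ∩ W = C ∧ 2 ≤ C.card := by
  simp only [survivingBlocks, Finset.mem_filter, Finset.mem_image, mem_strongBlocksOn]
  constructor
  · rintro ⟨⟨B, hB, h⟩, hC⟩
    exact ⟨B, hB, by convert h, hC⟩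
  · rintro ⟨B, hB, h, hC⟩
    exact ⟨⟨B, hB, by convert h⟩, hC⟩

/-- A surviving part contains an edge. -/
theorem exists_adj_of_mem_survivingBlocks (hG : G.toSimpleGraphInclusive.Preconnected)
    {W C : Finset V} (hW : G.StronglyConnectedOn W) (hC : C ∈ G.survivingBlocks W) :
    ∃ x ∈ C, ∃ y ∈ C, G.toSimpleGraphInclusive.Adj x y := by
  obtain ⟨B, hB, rfl, hcard⟩ := mem_survivingBlocks.1 hC
  obtain ⟨x, hx, y, hy, hxy⟩ := Finset.one_lt_card.1 hcard
  rw [Finset.mem_inter] at hx hy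
  obtain ⟨p, hp⟩ := hW.exists_walk hx.2 hy.2
  have hpC : ∀ z ∈ (p.toPath : G.toSimpleGraphInclusive.Walk x y).support, z ∈ B ∩ W :=
    fun z hz => Finset.mem_inter.2
      ⟨Inseparable.support_subset (hB.maximal_inseparable hG) hx.1 hy.1 p.toPath.2 z hz,
        hp z (p.support_toPath_subset_support hz)⟩
  generalize (p.toPath : G.toSimpleGraphInclusive.Walk x y) = q at hpC
  cases q with
  | nil => exact absurd rfl hxy
  | cons h q => exact ⟨x, hpC x (by simp), _, hpC _ (by simp), h⟩

theorem strongBlocksOn_eq_survivingBlocks (hG : G.toSimpleGraphInclusive.Preconnected)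
    {W : Finset V} (hW : G.StronglyConnectedOn W)
    (h : G.strongBlocksOn W ⊆ G.survivingBlocks W) :
    G.strongBlocksOn W = G.survivingBlocks W := by
  refine h.antisymm fun C hC => ?_
  -- An edge inside `C` extends to a strong block `D` of the subgraph on `W`. By `h`, `D` is the
  -- trace of some `B'`, and `B'` shares both ends of the edge with `B`; so `B' = B` and `D = C`.
  obtain ⟨x, hx, y, hy, hxy⟩ := exists_adj_of_mem_survivingBlocks hG hW hC
  obtain ⟨B, hB, hBC, hcard⟩ := mem_survivingBlocks.1 hC
  have hCW : C ⊆ W := hBC ▸ Finset.inter_subset_right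
  have hCB : C ⊆ B := hBC ▸ Finset.inter_subset_left
  obtain ⟨D, hxyD, hD⟩ := Finite.exists_le_maximal
    (p := fun D : Finset V => D ⊆ W ∧ G.IsNonseparableOn D) (a := {x, y})
    ⟨by
      rw [Finset.insert_subset_iff, Finset.singleton_subset_iff]
      exact ⟨hCW hx, hCW hy⟩, isNonseparableOn_pair hxy⟩
  have hD' := mem_strongBlocksOn.2 hD
  obtain ⟨B', hB', hBD, -⟩ := mem_survivingBlocks.1 (h hD')
  have hDB : D ⊆ B' := hBD ▸ Finset.inter_subset_left
  have hBB : B = B' := hB.eq_of_mem hG hB' hxy.ne (hCB hx) (hCB hy)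
    (hDB (hxyD (by simp))) (hDB (hxyD (by simp)))
  rwa [← hBC, hBB, hBD]

end Digraph

/-! ### The product formula and the vanishing of `κ`. -/

namespace BlockDatum

open Digraph Matrix SimpleGraph

variable {V : Type*} [Fintype V] {G : Digraph V} {R : Type*} [CommRing R] (𝒢 : BlockDatum G R)

section

variable [DecidableEq V]

open scoped Classical in
/-- The invariant `κ(D, v)` for some node `v ∈ C`, and `1` if there is none. -/
noncomputable def kappaPart (C : Finset V) : R :=
  if h : C.Nonempty then 𝒢.kappaOn C h.choose else 1

theorem kappaPart_eq (hG : G.toSimpleGraphInclusive.Preconnected) {B C : Finset V}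
    (hB : G.IsStrongBlockOn Finset.univ B) (hC : C ⊆ B) {v : V} (hv : v ∈ C) :
    𝒢.kappaPart C = 𝒢.kappaOn C v := by
  have h : C.Nonempty := ⟨v, hv⟩
  rw [kappaPart, dif_pos h, 𝒢.kappaOn_eq_of_subset hG ⟨B, hB⟩ hC h.choose_spec,
    𝒢.kappaOn_eq_of_subset hG ⟨B, hB⟩ hC hv]

theorem kappaPart_eq_one {C : Finset V} (hC : C.card ≤ 1) : 𝒢.kappaPart C = 1 := by
  by_cases h : C.Nonempty
  · obtain ⟨v, rfl⟩ := Finset.card_eq_one.1 (le_antisymm hC h.card_pos)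
    rw [kappaPart, dif_pos h, Finset.mem_singleton.1 h.choose_spec, kappaOn_singleton]
  · rw [kappaPart, dif_neg h]

/-- The product runs over all blocks of `G`, so that its index set stays fixed while `W` shrinks;
traces with at most one vertex contribute `1`. -/
theorem kappaOn_eq_prod_kappaPart (hG : G.toSimpleGraphInclusive.Preconnected) :
    ∀ (n : ℕ) {W : Finset V} {v₀ : V}, W.card = n → G.SeparatorClosed W → v₀ ∈ W →
      𝒢.kappaOn W v₀ = ∏ B ∈ G.strongBlocksOn Finset.univ, 𝒢.kappaPart (B ∩ W) := by
  classical
  intro n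
  induction n using Nat.strong_induction_on with
  | _ n ih =>
    intro W v₀ hn hW hv₀
    by_cases hs : ∃ i ∈ W, ∃ j ∈ W, ∃ v, G.Separates v i j
    · obtain ⟨t, ht, s, hsW, v, hv, htv₀⟩ : ∃ t ∈ W, ∃ s ∈ W, ∃ v, G.Separates v t s ∧
          ¬ G.toSimpleGraphInclusive.ReachableAvoiding v t v₀ := by
        obtain ⟨i, hi, j, hj, v, hv⟩ := hs
        by_cases h : G.toSimpleGraphInclusive.ReachableAvoiding v i v₀
        · exact ⟨j, hj, i, hi, v, hv.symm, fun h' =>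
            ((separates_iff hG).1 hv).2.2 (h.trans h'.symm)⟩
        · exact ⟨i, hi, j, hj, v, hv, h⟩
      have hvW : v ∈ W := hW t ht s hsW v hv
      obtain ⟨hvt, hvs, hts⟩ := (separates_iff hG).1 hv
      obtain ⟨A, hA⟩ : ∃ A : Finset V, ∀ x, x ∈ A ↔
          x ∈ W ∧ G.toSimpleGraphInclusive.ReachableAvoiding v t x :=
        ⟨W.filter fun x => G.toSimpleGraphInclusive.ReachableAvoiding v t x, by simp⟩
      have hAW : A ⊆ W := fun x hx => ((hA x).1 hx).1
      have hvA : v ∉ A := fun h => ((hA v).1 h).2.ne_right rfl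
      have htA : t ∈ A := (hA t).2 ⟨ht, .refl hvt⟩
      have hUW : W \ A ⊆ W := Finset.sdiff_subset
      have hTW : insert v A ⊆ W := Finset.insert_subset hvW hAW
      have hvU : v ∈ W \ A := Finset.mem_sdiff.2 ⟨hvW, hvA⟩
      have hclosed : ∀ x ∈ A, ∀ u ∈ W,
          G.toSimpleGraphInclusive.ReachableAvoiding v x u → u ∈ A := fun x hx u hu h =>
        (hA u).2 ⟨hu, ((hA x).1 hx).2.trans h⟩
      have hU : G.SeparatorClosed (W \ A) :=
        hW.of_forall hG hUW (fun x hx u hu huU _ h => by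
          rw [Finset.mem_sdiff] at hx huU
          exact hx.2 (hclosed u (by tauto) x hx.1 h.symm)) hvU
      have hT : G.SeparatorClosed (insert v A) :=
        hW.of_forall hG hTW (fun x hx u hu huT hxv h => huT (Finset.mem_insert_of_mem
          (hclosed x ((Finset.mem_insert.1 hx).resolve_left hxv) u hu h)))
          (Finset.mem_insert_self v A)
      have hUcard : (W \ A).card < n := hn ▸ Finset.card_lt_card
        ((Finset.ssubset_iff_of_subset hUW).2 ⟨t, ht, by simp [htA]⟩)
      have hTcard : (insert v A).card < n := hn ▸ Finset.card_lt_card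
        ((Finset.ssubset_iff_of_subset hTW).2 ⟨s, hsW, fun h => hts
          ((hA s).1 ((Finset.mem_insert.1 h).resolve_left hvs.symm)).2⟩)
      have hv₀U : v₀ ∈ W \ A := Finset.mem_sdiff.2 ⟨hv₀, fun h => htv₀ ((hA v₀).1 h).2⟩
      have hTe : (insert v A).erase v = A := Finset.erase_insert hvA
      have hUT : (W \ A) ∪ insert v A = W := by
        ext x
        have h1 := @hAW x
        have h2 : x = v → x ∈ W := fun h => h ▸ hvW
        simp only [Finset.mem_union, Finset.mem_sdiff, Finset.mem_insert]
        tauto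
      have hsplit := 𝒢.kappaOn_union hG hv₀U hvU (T := insert v A)
        (hTe.symm ▸ Finset.sdiff_disjoint) (fun x hx y hy hyv => by
          rw [hTe] at hx
          rw [Finset.mem_sdiff] at hy
          exact (separates_iff hG).2 ⟨((hA x).1 hx).2.ne_right, hyv.symm,
            fun h => hy.2 (hclosed x hx y hy.1 h)⟩)
      rw [hUT] at hsplit
      rw [hsplit, ih _ hUcard rfl hU hv₀U, ih _ hTcard rfl hT (Finset.mem_insert_self v A),
        ← Finset.prod_mul_distrib]
      refine Finset.prod_congr rfl fun B hB => ?_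
      have hBi := (mem_strongBlocksOn.1 hB).inseparable
      -- An inseparable block has its whole trace on one side of `v`; on the other side at most `v`
      -- remains, giving the factor `1`.
      by_cases hBA : ∃ x ∈ B, x ∈ A
      · obtain ⟨x, hxB, hxA⟩ := hBA
        have hyA : ∀ y ∈ B, y ∈ W → y ≠ v → y ∈ A := fun y hy hyW hyv => hclosed x hxA y hyW
          (hBi x hxB y hy v ((hA x).1 hxA).2.ne_right hyv.symm)
        have h1 : B ∩ (W \ A) ⊆ {v} := fun y hy => by
          simp only [Finset.mem_inter, Finset.mem_sdiff] at hy
          rw [Finset.mem_singleton]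
          by_contra hyv
          exact hy.2.2 (hyA y hy.1 hy.2.1 hyv)
        have h2 : B ∩ insert v A = B ∩ W :=
          (Finset.inter_subset_inter_left hTW).antisymm fun y hy => by
            rw [Finset.mem_inter] at hy
            rw [Finset.mem_inter, Finset.mem_insert]
            exact ⟨hy.1, or_iff_not_imp_left.2 (hyA y hy.1 hy.2)⟩
        rw [h2, 𝒢.kappaPart_eq_one ((Finset.card_le_card h1).trans_eq (Finset.card_singleton v)),
          one_mul]
      · push Not at hBA
        have h1 : B ∩ insert v A ⊆ {v} := fun y hy => by
          rw [Finset.mem_inter, Finset.mem_insert] at hy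
          exact Finset.mem_singleton.2 (hy.2.resolve_right (hBA y hy.1))
        have h2 : B ∩ (W \ A) = B ∩ W :=
          (Finset.inter_subset_inter_left hUW).antisymm fun y hy => by
            rw [Finset.mem_inter] at hy
            exact Finset.mem_inter.2 ⟨hy.1, Finset.mem_sdiff.2 ⟨hy.2, hBA y hy.1⟩⟩
        rw [h2, 𝒢.kappaPart_eq_one ((Finset.card_le_card h1).trans_eq (Finset.card_singleton v)),
          mul_one]
    · have hWi : G.toSimpleGraphInclusive.Inseparable W := fun x hx y hy v hvx hvy => by
        by_contra h
        exact hs ⟨x, hx, y, hy, v, (separates_iff hG).2 ⟨hvx, hvy, h⟩⟩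
      obtain ⟨B, hB, hWB⟩ := exists_strongBlock_of_inseparable hG hWi ⟨v₀, hv₀⟩
      rw [Finset.prod_eq_single_of_mem B (mem_strongBlocksOn.2 hB),
        Finset.inter_eq_right.2 hWB, 𝒢.kappaPart_eq hG hB hWB hv₀]
      intro B' hB' hne
      refine 𝒢.kappaPart_eq_one (not_lt.1 fun h => hne ?_)
      exact (mem_strongBlocksOn.1 hB').eq_of_two_le_card hG hB h Finset.inter_subset_left
        (Finset.inter_subset_right.trans hWB)

/-- The product formula for `κ(D_𝒢|_W, v₀)`. -/
theorem kappaOn_eq_prod_survivingBlocks (hG : G.toSimpleGraphInclusive.Preconnected)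
    {W : Finset V} (hW : G.SeparatorClosed W) {v₀ : V} (hv₀ : v₀ ∈ W) (c : Finset V → V)
    (hc : ∀ B ∈ G.survivingBlocks W, c B ∈ B) :
    𝒢.kappaOn W v₀ = ∏ B ∈ G.survivingBlocks W, 𝒢.kappaOn B (c B) := by
  rw [𝒢.kappaOn_eq_prod_kappaPart hG _ rfl hW hv₀]
  have h1 : ∏ B ∈ G.strongBlocksOn Finset.univ with 2 ≤ (B ∩ W).card, 𝒢.kappaPart (B ∩ W) =
      ∏ B ∈ G.strongBlocksOn Finset.univ, 𝒢.kappaPart (B ∩ W) := by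
    refine Finset.prod_filter_of_ne fun B _ h => ?_
    by_contra h'
    exact h (𝒢.kappaPart_eq_one (by omega))
  rw [← h1]
  have hmaps : ∀ B ∈ (G.strongBlocksOn Finset.univ).filter fun B => 2 ≤ (B ∩ W).card,
      B ∩ W ∈ G.survivingBlocks W := by
    intro B hB
    rw [Finset.mem_filter, mem_strongBlocksOn] at hB
    exact mem_survivingBlocks.2 ⟨B, hB.1, rfl, hB.2⟩
  -- Traces with two vertices determine their block, so no factor is lost in the image.
  refine Finset.prod_nbij (fun B => B ∩ W) hmaps ?_ ?_ ?_
  · intro B hB B' hB' h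
    simp only [Finset.coe_filter, Set.mem_ofPred_eq, mem_strongBlocksOn] at hB hB' h
    exact hB.1.eq_of_two_le_card hG hB'.1 hB.2 Finset.inter_subset_left
      (h ▸ Finset.inter_subset_left)
  · intro C hC
    obtain ⟨B, hB, rfl, hcard⟩ := mem_survivingBlocks.1 hC
    exact ⟨B, by simp [mem_strongBlocksOn, hB, hcard], rfl⟩
  · intro B hB
    have hB' := mem_strongBlocksOn.1 (Finset.mem_of_mem_filter B hB)
    exact 𝒢.kappaPart_eq hG hB' Finset.inter_subset_left (hc _ (hmaps B hB))

end

variable [LinearOrder V]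

/-- Rows and columns have the same enumeration here, so reindexing both introduces no sign. -/
theorem kappa_self (I : Finset V) (v₀ : V) (hcard : I.card = I.card) (h₁ h₂ : v₀ ∉ I) :
    𝒢.kappa I I v₀ hcard h₁ h₂ = 𝒢.kappaOn Iᶜ v₀ := by
  have h : (insert v₀ I)ᶜ = Iᶜ.erase v₀ := by
    ext x
    simp
  rw [kappaOn_eq_det, ← det_of_finset_congr h fun _ _ _ _ => rfl,
    ← det_submatrix_equiv_self ((insert v₀ I)ᶜ.orderIsoOfFin rfl).toEquiv]
  rfl

/-- If some row is attached through a vertex outside, then `κ` vanishes. -/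
theorem kappa_eq_zero (hG : G.toSimpleGraphInclusive.Preconnected) {I J : Finset V}
    (hcard : I.card = J.card) (hne : I ≠ J) (hJI : G.ConnectedThroughCutVertex J I) {v₀ : V}
    (h₁ : v₀ ∉ I) (h₂ : v₀ ∉ J) : 𝒢.kappa I J v₀ hcard h₁ h₂ = 0 := by
  obtain ⟨j, hj⟩ : (J \ I).Nonempty := by
    rw [Finset.nonempty_iff_ne_empty, ne_eq, Finset.sdiff_eq_empty_iff_subset]
    exact fun h => hne (Finset.eq_of_subset_of_card_le h hcard.le).symm
  obtain ⟨c, ⟨hc, -, hpath⟩, -⟩ := hJI j hj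
  rw [Finset.mem_sdiff] at hj
  rw [Finset.mem_union, not_or] at hc
  have hcj : c ≠ j := fun h => hc.1 (h ▸ hj.1)
  have hsep : ∀ k ∉ J, k ≠ c → G.Separates c j k := fun k hk hkc =>
    ⟨hcj, hkc.symm, hG j k, hpath k hk⟩
  have hm : ∀ k ∉ J, 𝒢.multDist j k = 𝒢.multDist j c * 𝒢.multDist c k := by
    intro k hk
    by_cases h : k = c
    · rw [h, 𝒢.multDist_self hG, mul_one]
    · exact 𝒢.multDist_of_separates hG (hsep k hk h)
  have hd : ∀ k ∉ J, 𝒢.dist j k = 𝒢.dist j c + 𝒢.multDist j c * 𝒢.dist c k := by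
    intro k hk
    by_cases h : k = c
    · rw [h, 𝒢.dist_self hG, mul_zero, add_zero]
    · exact 𝒢.dist_of_separates hG (hsep k hk h)
  have hrow : ∀ k ∉ J, 𝒢.basedDist v₀ j k = 𝒢.multDist j c * 𝒢.basedDist v₀ c k := by
    intro k hk
    rw [basedDist, basedDist, hd k hk, hd v₀ h₂, hm v₀ h₂]
    ring
  have hcol : ∀ t, (insert v₀ J)ᶜ.orderEmbOfFin (card_compl_insert_eq hcard h₁ h₂).symm t ∉ J :=
    fun t h => by
      have := Finset.orderEmbOfFin_mem _ (card_compl_insert_eq hcard h₁ h₂).symm t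
      rw [Finset.mem_compl, Finset.mem_insert, not_or] at this
      exact this.2 h
  have hsurj : ∀ x ∉ I, x ≠ v₀ → ∃ s, (insert v₀ I)ᶜ.orderEmbOfFin rfl s = x := by
    intro x hx hxv
    have : x ∈ Set.range ((insert v₀ I)ᶜ.orderEmbOfFin rfl) := by
      rw [Finset.range_orderEmbOfFin]
      simp [hx, hxv]
    exact this
  obtain ⟨s, hs⟩ := hsurj j hj.2 fun h => h₂ (h ▸ hj.1)
  -- For `c = v₀` the matrix has no row `c`, but row `j` is then a multiple of `b_{v₀}(v₀, ·) = 0`.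
  by_cases hcv : c = v₀
  · refine det_eq_zero_of_row_eq_zero s fun t => ?_
    change 𝒢.basedDist v₀ _ _ = 0
    rw [hs, hrow _ (hcol t), hcv, 𝒢.basedDist_self hG, mul_zero]
  · obtain ⟨s', hs'⟩ := hsurj c hc.2 hcv
    refine det_eq_zero_of_row_eq_smul (i := s) (j := s') ?_ (𝒢.multDist j c) fun t => ?_
    · rintro rfl
      exact hcj (hs'.symm.trans hs)
    · change 𝒢.basedDist v₀ _ _ = 𝒢.multDist j c * 𝒢.basedDist v₀ _ _
      rw [hs, hs', hrow _ (hcol t)]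

end BlockDatum

theorem mainTheorem4 {V : Type*} [Fintype V] [LinearOrder V] {R : Type*} [CommRing R]
    (G : Digraph V) (hsimple : ∀ v, ¬ G.Adj v v) (hG : G.StronglyConnectedOn Finset.univ)
    (𝒢 : BlockDatum G R) (I J : Finset V)
    (hcard : I.card = J.card) (hsize : I.card + 3 ≤ Fintype.card V)
    (hIJ : G.ConnectedThroughCutVertex I J) (hJI : G.ConnectedThroughCutVertex J I)
    (hI : G.StronglyConnectedOn Iᶜ) (hJ : G.StronglyConnectedOn Jᶜ)
    (hinter : G.StronglyConnectedOn (I ∩ J)ᶜ) :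
    -- the value for `I = J`, with an arbitrary base vertex `c B` in each `B`
    (I = J → ∀ (v₀ : V) (h₁ : v₀ ∉ I) (h₂ : v₀ ∉ J)
      (c : Finset V → V) (_ : ∀ B ∈ G.survivingBlocks (I ∩ J)ᶜ, c B ∈ B),
      𝒢.kappa I J v₀ hcard h₁ h₂ =
        ∏ B ∈ G.survivingBlocks (I ∩ J)ᶜ, 𝒢.kappaOn B (c B)) ∧
    -- if the strong blocks of the induced subgraph are surviving parts of strong blocks of `G`,
    -- then the product may be taken over the strong blocks of the induced subgraph
    (I = J → G.strongBlocksOn (I ∩ J)ᶜ ⊆ G.survivingBlocks (I ∩ J)ᶜ →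
      ∀ (v₀ : V) (h₁ : v₀ ∉ I) (h₂ : v₀ ∉ J)
      (c : Finset V → V) (_ : ∀ B ∈ G.strongBlocksOn (I ∩ J)ᶜ, c B ∈ B),
      𝒢.kappa I J v₀ hcard h₁ h₂ =
        ∏ B ∈ G.strongBlocksOn (I ∩ J)ᶜ, 𝒢.kappaOn B (c B)) ∧
    -- the value for `I ≠ J`
    (I ≠ J → ∀ (v₀ : V) (h₁ : v₀ ∉ I) (h₂ : v₀ ∉ J), 𝒢.kappa I J v₀ hcard h₁ h₂ = 0) ∧
    -- independence of the vertex
    (∀ (v₀ v₁ : V) (h₁ : v₀ ∉ I) (h₂ : v₀ ∉ J) (h₃ : v₁ ∉ I) (h₄ : v₁ ∉ J),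
      𝒢.kappa I J v₀ hcard h₁ h₂ = 𝒢.kappa I J v₁ hcard h₃ h₄) := by
  have hconn := hG.preconnected
  have hzero : I ≠ J → ∀ (v₀ : V) (h₁ : v₀ ∉ I) (h₂ : v₀ ∉ J),
      𝒢.kappa I J v₀ hcard h₁ h₂ = 0 := fun hne v₀ h₁ h₂ =>
    𝒢.kappa_eq_zero hconn hcard hne hJI h₁ h₂
  have hprod : I = J → ∀ (v₀ : V) (h₁ : v₀ ∉ I) (h₂ : v₀ ∉ J)
      (c : Finset V → V) (_ : ∀ B ∈ G.survivingBlocks (I ∩ J)ᶜ, c B ∈ B),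
      𝒢.kappa I J v₀ hcard h₁ h₂ =
        ∏ B ∈ G.survivingBlocks (I ∩ J)ᶜ, 𝒢.kappaOn B (c B) := by
    rintro rfl v₀ h₁ h₂ c hc
    rw [𝒢.kappa_self]
    rw [Finset.inter_self] at hc ⊢
    exact 𝒢.kappaOn_eq_prod_survivingBlocks hconn hI.separatorClosed (Finset.mem_compl.2 h₁) c hc
  refine ⟨hprod, fun hEq hsub v₀ h₁ h₂ c hc => ?_, hzero, fun v₀ v₁ h₁ h₂ h₃ h₄ => ?_⟩
  · have hblocks := Digraph.strongBlocksOn_eq_survivingBlocks hconn hinter hsub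
    rw [hblocks] at hc ⊢
    exact hprod hEq v₀ h₁ h₂ c hc
  · by_cases hEq : I = J
    · have hc : ∀ B : Finset V, ∃ x, B ∈ G.survivingBlocks (I ∩ J)ᶜ → x ∈ B := by
        intro B
        by_cases hB : B.Nonempty
        · exact ⟨hB.choose, fun _ => hB.choose_spec⟩
        -- `v₀` is a dummy value: surviving parts have at least two vertices and are never empty.
        · refine ⟨v₀, fun h => absurd ?_ hB⟩
          obtain ⟨-, -, -, h⟩ := Digraph.mem_survivingBlocks.1 h
          exact Finset.card_pos.1 (by omega)
      choose c hc using hc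
      rw [hprod hEq v₀ h₁ h₂ c hc, hprod hEq v₁ h₃ h₄ c hc]
    · rw [hzero hEq v₀ h₁ h₂, hzero hEq v₁ h₃ h₄]
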